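/- Let $V=\bigoplus_{k\ge 2}V^k$ be a graded $\mathbb{Q}$-vector space, let $\Lambda V$ be the free graded commutative algebra on $V$, and let $(\Lambda V,\partial)$ be a simply connected free commutative cochain algebra, minimal in the sense that $\partial V^k\subseteq \Lambda V^{\le k-1}$ for all $k$, where $\Lambda V^{\le k}\subseteq\Lambda V$ denotes the subalgebra generated by the $V^j$ with $j\le k$ (so every $(\Lambda V^{\le k},\partial)$ is a sub cochain algebra). Let $\mathcal{E}(\Lambda V^{\le n})=\mathrm{aut}(\Lambda V^{\le n},\partial)/\!\simeq$ be the group of homotopy classes of automorphisms of the cochain algebra $(\Lambda V^{\le n},\partial)$, where homotopies are defined by morphisms into $(\Lambda V^{\le n})\otimes\Lambda(t,dt)$, and let $$b^n: V^n\longrightarrow H^{n+1}(\Lambda V^{\le n-1}),\qquad b^n(v)=[\partial v].$$ For every $n$: if the group $\mathcal{E}(\Lambda V^{\le n})$ is finite, then the linear map $b^n$ is injective. Moreover, if $0\neq v\in V^n$ satisfies $b^n(v)=0$ and $W$ is any linear complement of $\mathbb{Q}v$ in $V^n$, then there are automorphisms $\alpha_a$ of $(\Lambda V^{\le n},\partial)$,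 for $a\in\mathbb{Q}\setminus\{0\}$, with pairwise distinct classes $[\alpha_a]\in\mathcal{E}(\Lambda V^{\le n})$, such that $\alpha_a$ is the identity on $\Lambda V^{\le n-1}$ and, modulo $\Lambda V^{\le n-1}$, $\alpha_a(v)\equiv a v$ and $\alpha_a(w)\equiv w$ for all $w\in W$; in particular $\mathcal{E}(\Lambda V^{\le n})$ is infinite. -/

import Mathlib

open scoped Polynomial

noncomputable section

/-- The structure of a cochain algebra over `ℚ` on an associative algebra `A`: a direct sum
decomposition `A = ⨁ A^k` (`k ≥ 0`) compatible with the product, and a differential of degree `+1`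
which is a (graded) derivation. -/
structure CochainAlgebra (A : Type*) [Ring A] [Algebra ℚ A] where
  deg : ℕ → Submodule ℚ A
  internal : DirectSum.IsInternal deg
  one_mem : (1 : A) ∈ deg 0
  mul_mem : ∀ {i j : ℕ} {x y : A}, x ∈ deg i → y ∈ deg j → x * y ∈ deg (i + j)
  d : A →ₗ[ℚ] A
  d_mem : ∀ {i : ℕ} {x : A}, x ∈ deg i → d x ∈ deg (i + 1)
  d_d : ∀ x : A, d (d x) = 0
  leibniz : ∀ {i : ℕ} {x : A}, x ∈ deg i → ∀ y : A,
    d (x * y) = d x * y + (-1) ^ i * (x * d y)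

namespace CochainAlgebra

variable {A : Type*} [Ring A] [Algebra ℚ A]

/-! ### Cohomology -/

/-- The cocycles of degree `k`. -/
def cocycles (𝒜 : CochainAlgebra A) (k : ℕ) : Submodule ℚ A :=
  𝒜.deg k ⊓ LinearMap.ker 𝒜.d

/-- The coboundaries of degree `k`: the image of `d : A^{k-1} → A^k`. -/
def coboundaries (𝒜 : CochainAlgebra A) : ℕ → Submodule ℚ A
  | 0 => ⊥
  | k + 1 => (𝒜.deg k).map 𝒜.d

/-- The cohomology `H^k(A, d)`, cocycles modulo coboundaries. -/
abbrev cohomology (𝒜 : CochainAlgebra A) (k : ℕ) : Type _ :=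
  𝒜.cocycles k ⧸ (𝒜.coboundaries k).submoduleOf (𝒜.cocycles k)

/-! ### Automorphisms and homotopy -/

/-- The group `aut(A, d)`: algebra automorphisms preserving the degree and commuting with `d`. -/
def aut (𝒜 : CochainAlgebra A) : Subgroup (A ≃ₐ[ℚ] A) where
  carrier := {α | (∀ k x, α x ∈ 𝒜.deg k ↔ x ∈ 𝒜.deg k) ∧ ∀ x, α (𝒜.d x) = 𝒜.d (α x)}
  one_mem' := ⟨fun _ _ => Iff.rfl, fun _ => rfl⟩
  mul_mem' {α β} hα hβ :=
    ⟨fun k x => (hα.1 k (β x)).trans (hβ.1 k x), fun x => by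
      simp only [AlgEquiv.mul_apply, hβ.2, hα.2]⟩
  inv_mem' {α} hα :=
    ⟨fun k x => by
      rw [← hα.1 k (α⁻¹ x)]
      change α (α.symm x) ∈ _ ↔ _
      rw [AlgEquiv.apply_symm_apply],
     fun x => by
      apply α.injective
      rw [hα.2]
      change α (α.symm _) = 𝒜.d (α (α.symm x))
      rw [AlgEquiv.apply_symm_apply, AlgEquiv.apply_symm_apply]⟩

/-- A homotopy `H : A → A ⊗ Λ(t, dt)` from `α` to `β`, where `Λ(t, dt)` is the free commutative
cochain algebra on `t` in degree `0` and `dt = d(t)` in degree `1`.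

As a vector space `A ⊗ Λ(t, dt) = A[t] ⊕ A[t] dt`, so `H` is written `H x = Φ x + (Ψ x) dt`.
Since `dt · a = (-1)^{|a|} a · dt`, the conditions that `H` is multiplicative, preserves degrees
(`|dt| = 1`) and commutes with the differential
`d (a t^i) = (d a) t^i + (-1)^{|a|} i a t^{i-1} dt`, `d (a t^i dt) = (d a) t^i dt`
are the ones below. The augmentations `t ↦ 0, dt ↦ 0` and `t ↦ 1, dt ↦ 0` send `H` to `α`
and `β`. -/
structure Homotopy (𝒜 : CochainAlgebra A) (α β : A →ₐ[ℚ] A) where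
  Φ : A →ₐ[ℚ] A[X]
  Ψ : A →ₗ[ℚ] A[X]
  Ψ_mul : ∀ {j : ℕ} (x : A) {y : A}, y ∈ 𝒜.deg j →
    Ψ (x * y) = Φ x * Ψ y + (-1) ^ j * (Ψ x * Φ y)
  Φ_mem : ∀ {k : ℕ} {x : A}, x ∈ 𝒜.deg k → ∀ i, (Φ x).coeff i ∈ 𝒜.deg k
  Ψ_zero : ∀ {x : A}, x ∈ 𝒜.deg 0 → Ψ x = 0
  Ψ_mem : ∀ {k : ℕ} {x : A}, x ∈ 𝒜.deg (k + 1) → ∀ i, (Ψ x).coeff i ∈ 𝒜.deg k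
  Φ_d : ∀ x i, (Φ (𝒜.d x)).coeff i = 𝒜.d ((Φ x).coeff i)
  Ψ_d : ∀ {k : ℕ} {x : A}, x ∈ 𝒜.deg k → ∀ i,
    (Ψ (𝒜.d x)).coeff i =
      𝒜.d ((Ψ x).coeff i) + (-1) ^ k * (Polynomial.derivative (Φ x)).coeff i
  eval_zero : ∀ x, (Φ x).eval 0 = α x
  eval_one : ∀ x, (Φ x).eval 1 = β x

/-- The homotopy relation between automorphisms of `(A, d)`. -/
def Homotopic (𝒜 : CochainAlgebra A) (α β : 𝒜.aut) : Prop :=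
  Nonempty (𝒜.Homotopy (α : A ≃ₐ[ℚ] A).toAlgHom (β : A ≃ₐ[ℚ] A).toAlgHom)

/-- Homotopies can be composed with automorphisms on the right. -/
theorem Homotopic.mul_right {𝒜 : CochainAlgebra A} {α β : 𝒜.aut} (h : 𝒜.Homotopic α β)
    (γ : 𝒜.aut) : 𝒜.Homotopic (α * γ) (β * γ) := by
  obtain ⟨H⟩ := h
  obtain ⟨γ, hγ, hγd⟩ := γ
  exact ⟨{
    Φ := H.Φ.comp γ.toAlgHom
    Ψ := H.Ψ ∘ₗ γ.toLinearMap
    Ψ_mul := fun {_} x {y} hy => by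
      have := H.Ψ_mul (γ x) ((hγ _ _).2 hy)
      simpa using this
    Φ_mem := fun hx i => H.Φ_mem ((hγ _ _).2 hx) i
    Ψ_zero := fun hx => H.Ψ_zero ((hγ _ _).2 hx)
    Ψ_mem := fun hx i => H.Ψ_mem ((hγ _ _).2 hx) i
    Φ_d := fun x i => by
      have := H.Φ_d (γ x) i
      simpa [hγd] using this
    Ψ_d := fun {k x} hx i => by
      have := H.Ψ_d ((hγ _ _).2 hx) i
      simpa [hγd] using this
    eval_zero := fun x => H.eval_zero (γ x)
    eval_one := fun x => H.eval_one (γ x) }⟩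

/-- Homotopies can be composed with automorphisms on the left. -/
theorem Homotopic.mul_left {𝒜 : CochainAlgebra A} {α β : 𝒜.aut} (h : 𝒜.Homotopic α β)
    (γ : 𝒜.aut) : 𝒜.Homotopic (γ * α) (γ * β) := by
  obtain ⟨H⟩ := h
  obtain ⟨γ, hγ, hγd⟩ := γ
  let m : A[X] →ₐ[ℚ] A[X] := Polynomial.mapAlgHom γ.toAlgHom
  have hm : ∀ p i, (m p).coeff i = γ (p.coeff i) := fun p i => by
    simp [m, Polynomial.coe_mapAlgHom, Polynomial.coeff_map]
  have he0 : ∀ p : A[X], (m p).eval 0 = γ (p.eval 0) := fun p => by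
    simp only [← Polynomial.coeff_zero_eq_eval_zero, hm]
  have he1 : ∀ p : A[X], (m p).eval 1 = γ (p.eval 1) := fun p => by
    have := Polynomial.eval_one_map (γ.toAlgHom : A →+* A) p
    simp only [m, Polynomial.coe_mapAlgHom]
    exact this
  exact ⟨{
    Φ := m.comp H.Φ
    Ψ := m.toLinearMap ∘ₗ H.Ψ
    Ψ_mul := fun {_} x {y} hy => by
      simp [H.Ψ_mul x hy]
    Φ_mem := fun hx i => by
      simp only [AlgHom.comp_apply, hm]
      exact (hγ _ _).2 (H.Φ_mem hx i)
    Ψ_zero := fun hx => by simp [H.Ψ_zero hx]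
    Ψ_mem := fun hx i => by
      simp only [LinearMap.comp_apply, AlgHom.toLinearMap_apply, hm]
      exact (hγ _ _).2 (H.Ψ_mem hx i)
    Φ_d := fun x i => by
      simp only [AlgHom.comp_apply, hm, H.Φ_d, hγd]
    Ψ_d := fun {k x} hx i => by
      simp only [AlgHom.comp_apply, LinearMap.comp_apply, AlgHom.toLinearMap_apply, hm, H.Ψ_d hx,
        Polynomial.coeff_derivative, map_add, map_mul, map_pow, map_neg, map_one, hγd, map_natCast]
    eval_zero := fun x => by
      simp only [AlgHom.comp_apply, he0, H.eval_zero]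
      rfl
    eval_one := fun x => by
      simp only [AlgHom.comp_apply, he1, H.eval_one]
      rfl }⟩

/-- The congruence on the group `aut(A, d)` given by homotopy. (On free simply connected algebras
homotopy is an equivalence relation, so that `Relation.EqvGen` adds nothing.) -/
def homotopyCon (𝒜 : CochainAlgebra A) : Con 𝒜.aut where
  r := Relation.EqvGen 𝒜.Homotopic
  iseqv := Relation.EqvGen.is_equivalence _
  mul' {a b c e} h₁ h₂ := by
    have hr : ∀ {x y : 𝒜.aut} (z : 𝒜.aut), Relation.EqvGen 𝒜.Homotopic x y →
        Relation.EqvGen 𝒜.Homotopic (x * z) (y * z) := fun z h => by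
      induction h with
      | rel _ _ h => exact .rel _ _ (h.mul_right z)
      | refl _ => exact .refl _
      | symm _ _ _ ih => exact .symm _ _ ih
      | trans _ _ _ _ _ ih₁ ih₂ => exact .trans _ _ _ ih₁ ih₂
    have hl : ∀ {x y : 𝒜.aut} (z : 𝒜.aut), Relation.EqvGen 𝒜.Homotopic x y →
        Relation.EqvGen 𝒜.Homotopic (z * x) (z * y) := fun z h => by
      induction h with
      | rel _ _ h => exact .rel _ _ (h.mul_left z)
      | refl _ => exact .refl _
      | symm _ _ _ ih => exact .symm _ _ ih
      | trans _ _ _ _ _ ih₁ ih₂ => exact .trans _ _ _ ih₁ ih₂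
    exact .trans _ _ _ (hr c h₁) (hl b h₂)

/-- The group `ℰ(A, d) = aut(A, d) / ≃` of homotopy classes of self-equivalences. -/
abbrev E (𝒜 : CochainAlgebra A) : Type _ := 𝒜.homotopyCon.Quotient

/-- The homotopy class `[α] ∈ ℰ(A, d)`. -/
def homotopyClass (𝒜 : CochainAlgebra A) : 𝒜.aut →* 𝒜.E := 𝒜.homotopyCon.mk'

/-! ### Sub cochain algebras -/

/-- A homogeneous subalgebra stable under the differential is a cochain algebra. -/
def sub (𝒜 : CochainAlgebra A) (S : Subalgebra ℚ A)
    (hS : S.toSubmodule ≤ ⨆ k, 𝒜.deg k ⊓ S.toSubmodule) (hd : ∀ x ∈ S, 𝒜.d x ∈ S) :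
    CochainAlgebra S where
  deg k := (𝒜.deg k).comap S.val.toLinearMap
  internal := by
    rw [DirectSum.isInternal_submodule_iff_iSupIndep_and_iSup_eq_top]
    have hind := ((DirectSum.isInternal_submodule_iff_iSupIndep_and_iSup_eq_top _).1
      𝒜.internal).1
    have hinj : Function.Injective S.val.toLinearMap := Subtype.val_injective
    have hmap : ∀ k, ((𝒜.deg k).comap S.val.toLinearMap).map S.val.toLinearMap =
        𝒜.deg k ⊓ S.toSubmodule := fun k => by
      ext x
      constructor
      · rintro ⟨y, hy, rfl⟩
        exact ⟨hy, y.2⟩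
      · rintro ⟨h₁, h₂⟩
        exact ⟨⟨x, h₂⟩, h₁, rfl⟩
    constructor
    · rw [iSupIndep_def]
      intro i
      rw [Submodule.disjoint_def]
      intro x hx hx'
      apply hinj
      rw [map_zero]
      refine (Submodule.disjoint_def.1 (iSupIndep_def.1 hind i)) _ hx ?_
      have h2 := Submodule.mem_map_of_mem (f := S.val.toLinearMap) hx'
      simp only [Submodule.map_iSup, hmap] at h2
      have hle : (⨆ j, ⨆ (_ : j ≠ i), 𝒜.deg j ⊓ S.toSubmodule) ≤ ⨆ j, ⨆ (_ : j ≠ i), 𝒜.deg j :=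
        iSup_mono fun j => iSup_mono fun _ => inf_le_left
      exact hle h2
    · rw [eq_top_iff]
      intro x _
      have h1 := hS x.2
      simp only [← hmap, ← Submodule.map_iSup] at h1
      obtain ⟨y, hy, hyx⟩ := h1
      rwa [← hinj hyx]
  one_mem := 𝒜.one_mem
  mul_mem hx hy := 𝒜.mul_mem hx hy
  d := 𝒜.d.restrict (p := S.toSubmodule) (q := S.toSubmodule) hd
  d_mem hx := 𝒜.d_mem hx
  d_d x := Subtype.ext (𝒜.d_d x)
  leibniz {i x} hx y := Subtype.ext (𝒜.leibniz (show (x : A) ∈ 𝒜.deg i from hx) y)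

end CochainAlgebra

/-! ### Free graded commutative algebras -/

section Free

variable (V : ℕ → Type*) [∀ k, AddCommGroup (V k)] [∀ k, Module ℚ (V k)]

/-- The relations `v w = (-1)^{|v||w|} w v` between homogeneous elements of the graded vector
space `V = ⨁ V^k`, in the tensor algebra. -/
inductive FreeCGA.Rel : TensorAlgebra ℚ (DirectSum ℕ V) → TensorAlgebra ℚ (DirectSum ℕ V) → Prop
  | comm (i j : ℕ) (v : V i) (w : V j) : FreeCGA.Rel
      (TensorAlgebra.ι ℚ (DirectSum.lof ℚ ℕ V i v) * TensorAlgebra.ι ℚ (DirectSum.lof ℚ ℕ V j w))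
      ((-1) ^ (i * j) *
        (TensorAlgebra.ι ℚ (DirectSum.lof ℚ ℕ V j w) *
          TensorAlgebra.ι ℚ (DirectSum.lof ℚ ℕ V i v)))

/-- The free graded commutative `ℚ`-algebra `ΛV` on a graded vector space `V = ⨁ V^k`:
the quotient of the tensor algebra by `v w = (-1)^{|v||w|} w v`. -/
def FreeCGA : Type _ := RingQuot (FreeCGA.Rel V)

instance : Ring (FreeCGA V) := inferInstanceAs (Ring (RingQuot (FreeCGA.Rel V)))

instance : Algebra ℚ (FreeCGA V) := inferInstanceAs (Algebra ℚ (RingQuot (FreeCGA.Rel V)))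

namespace FreeCGA

/-- The quotient map from the tensor algebra. -/
def mk : TensorAlgebra ℚ (DirectSum ℕ V) →ₐ[ℚ] FreeCGA V := RingQuot.mkAlgHom ℚ (Rel V)

/-- The inclusion `V^k → ΛV`. -/
def ι (k : ℕ) : V k →ₗ[ℚ] FreeCGA V :=
  (mk V).toLinearMap ∘ₗ TensorAlgebra.ι ℚ ∘ₗ DirectSum.lof ℚ ℕ V k

variable {V} in
theorem ι_mul_ι {i j : ℕ} (v : V i) (w : V j) :
    ι V i v * ι V j w = (-1) ^ (i * j) * (ι V j w * ι V i v) := by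
  have : mk V _ = mk V _ := RingQuot.mkAlgHom_rel ℚ (Rel.comm (V := V) i j v w)
  simpa [ι] using this

variable {V} in
/-- The universal property of `ΛV`. -/
def lift {B : Type*} [Ring B] [Algebra ℚ B] (f : ∀ k, V k →ₗ[ℚ] B)
    (hf : ∀ i j (v : V i) (w : V j), f i v * f j w = (-1) ^ (i * j) * (f j w * f i v)) :
    FreeCGA V →ₐ[ℚ] B :=
  RingQuot.liftAlgHom ℚ ⟨TensorAlgebra.lift ℚ (DirectSum.toModule ℚ ℕ B f), by
    rintro _ _ ⟨i, j, v, w⟩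
    simpa using hf i j v w⟩

variable {V} in
@[simp] theorem lift_ι {B : Type*} [Ring B] [Algebra ℚ B] (f : ∀ k, V k →ₗ[ℚ] B)
    (hf : ∀ i j (v : V i) (w : V j), f i v * f j w = (-1) ^ (i * j) * (f j w * f i v))
    (k : ℕ) (v : V k) : lift f hf (ι V k v) = f k v := by
  refine (RingQuot.liftAlgHom_mkAlgHom_apply ℚ _ _ _).trans ?_
  simp

variable {V} in
theorem hom_ext {B : Type*} [Ring B] [Algebra ℚ B] {f g : FreeCGA V →ₐ[ℚ] B}
    (h : ∀ k v, f (ι V k v) = g (ι V k v)) : f = g := by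
  apply RingQuot.ringQuot_ext'
  apply TensorAlgebra.hom_ext
  apply DirectSum.linearMap_ext
  intro k
  ext v
  exact h k v

/-- The degree `m` part of `ΛV`: the span of the products `v₁ ⋯ v_r` of homogeneous elements with
`|v₁| + ⋯ + |v_r| = m`. -/
def deg (m : ℕ) : Submodule ℚ (FreeCGA V) :=
  Submodule.span ℚ {x | ∃ l : List (Σ k, V k),
    (l.map Sigma.fst).sum = m ∧ (l.map fun p => ι V p.1 p.2).prod = x}

variable {V} in
theorem ι_mem_deg {k : ℕ} (v : V k) : ι V k v ∈ deg V k :=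
  Submodule.subset_span ⟨[⟨k, v⟩], by simp, by simp⟩

instance : SetLike.GradedMonoid (deg V) where
  one_mem := Submodule.subset_span ⟨[], by simp, by simp⟩
  mul_mem {i j} x y hx hy := by
    induction hx using Submodule.span_induction with
    | mem x hx =>
      induction hy using Submodule.span_induction with
      | mem y hy =>
        obtain ⟨l, hl, rfl⟩ := hx
        obtain ⟨l', hl', rfl⟩ := hy
        exact Submodule.subset_span ⟨l ++ l', by simp [hl, hl'], by simp⟩
      | zero => simp
      | add _ _ _ _ h₁ h₂ => rw [mul_add]; exact add_mem h₁ h₂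
      | smul c _ _ h => rw [mul_smul_comm]; exact Submodule.smul_mem _ c h
    | zero => simp
    | add _ _ _ _ h₁ h₂ => rw [add_mul]; exact add_mem h₁ h₂
    | smul c _ _ h => rw [smul_mul_assoc]; exact Submodule.smul_mem _ c h

/-- The algebra map `ΛV → (ΛV)[X]` with `v ↦ v X^k` for `v ∈ V^k`; it detects the degree. -/
def weight : FreeCGA V →ₐ[ℚ] (FreeCGA V)[X] :=
  lift (V := V) (fun k =>
    ((Polynomial.monomial k).restrictScalars ℚ : FreeCGA V →ₗ[ℚ] (FreeCGA V)[X]) ∘ₗ ι V k) (by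
      intro i j v w
      have h : ((-1 : (FreeCGA V)[X]) ^ (i * j)) = Polynomial.C ((-1) ^ (i * j)) := by simp
      simp only [LinearMap.comp_apply, LinearMap.restrictScalars_apply,
        Polynomial.monomial_mul_monomial, h, Polynomial.C_mul_monomial]
      rw [ι_mul_ι, add_comm])

variable {V} in
theorem weight_of_mem {m : ℕ} {x : FreeCGA V} (hx : x ∈ deg V m) :
    weight V x = Polynomial.monomial m x := by
  induction hx using Submodule.span_induction with
  | mem x hx =>
    obtain ⟨l, rfl, rfl⟩ := hx
    induction l with
    | nil => simp
    | cons p l ih =>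
      simp only [List.map_cons, List.prod_cons, List.sum_cons, map_mul, ih]
      rw [show weight V (ι V p.1 p.2) = Polynomial.monomial p.1 (ι V p.1 p.2) by simp [weight],
        Polynomial.monomial_mul_monomial]
  | zero => simp
  | add _ _ _ _ h₁ h₂ => simp [h₁, h₂]
  | smul c _ _ h => rw [map_smul, h, Polynomial.smul_monomial]

/-- The subalgebra `ΛV^{I}` of `ΛV` generated by the `V^k` with `k ∈ I`. Thus `ΛV^{≤ n}` is the
case `I = {k | k ≤ n}` and `ΛV^{≤ n-1}` the case `I = {k | k < n}`. -/
def trunc (I : Set ℕ) : Subalgebra ℚ (FreeCGA V) :=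
  Algebra.adjoin ℚ {x | ∃ k ∈ I, ∃ v : V k, ι V k v = x}

variable {V} in
theorem ι_mem_trunc {I : Set ℕ} {k : ℕ} (hk : k ∈ I) (v : V k) : ι V k v ∈ trunc V I :=
  Algebra.subset_adjoin ⟨k, hk, v, rfl⟩

theorem trunc_mono {I J : Set ℕ} (h : I ⊆ J) : trunc V I ≤ trunc V J :=
  Algebra.adjoin_mono fun _ ⟨k, hk, v, hv⟩ => ⟨k, h hk, v, hv⟩

theorem trunc_univ : trunc V Set.univ = ⊤ := by
  let f : FreeCGA V →ₐ[ℚ] trunc V Set.univ :=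
    lift (V := V) (fun k => (ι V k).codRestrict (trunc V Set.univ).toSubmodule
      fun v => ι_mem_trunc (Set.mem_univ k) v) fun i j v w => Subtype.ext (ι_mul_ι v w)
  have hf : (trunc V Set.univ).val.comp f = AlgHom.id ℚ _ := hom_ext fun k v => by
    simp only [f, AlgHom.comp_apply, lift_ι, AlgHom.id_apply]
    rfl
  rw [eq_top_iff]
  intro x _
  have := DFunLike.congr_fun hf x
  rw [AlgHom.id_apply] at this
  rw [← this]
  exact (f x).2

variable {V} in
/-- An element of `ΛV^{I}` is a linear combination of products of generators. -/
theorem trunc_induction {I : Set ℕ} {P : Submodule ℚ (FreeCGA V)} (one : 1 ∈ P)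
    (mul : ∀ k ∈ I, ∀ (v : V k), ∀ y ∈ trunc V I, y ∈ P → ι V k v * y ∈ P) {x : FreeCGA V}
    (hx : x ∈ trunc V I) : x ∈ P := by
  have hx' : x ∈ (trunc V I).toSubmodule := hx
  rw [trunc, Algebra.adjoin_eq_span] at hx'
  refine (Submodule.span_le.2 ?_) hx'
  intro y hy
  have : y ∈ P ∧ y ∈ trunc V I := by
    induction hy using Submonoid.closure_induction_left with
    | one => exact ⟨one, one_mem _⟩
    | mul_left g hg y _ ih =>
      obtain ⟨k, hk, v, rfl⟩ := hg
      exact ⟨mul k hk v y ih.2 ih.1, mul_mem (ι_mem_trunc hk v) ih.2⟩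
  exact this.1

theorem trunc_le_iSup (I : Set ℕ) : (trunc V I).toSubmodule ≤
    ⨆ k, deg V k ⊓ (trunc V I).toSubmodule := by
  intro x hx
  refine trunc_induction (I := I) ?_ ?_ hx
  · exact Submodule.mem_iSup_of_mem 0 ⟨SetLike.one_mem_graded (deg V), one_mem (trunc V I)⟩
  · intro k hk v y hy' hy
    clear hy'
    induction hy using Submodule.iSup_induction' with
    | mem j y hy =>
      exact Submodule.mem_iSup_of_mem (k + j)
        ⟨SetLike.mul_mem_graded (ι_mem_deg v) hy.1,
          mul_mem (S := Subalgebra ℚ (FreeCGA V)) (ι_mem_trunc hk v) hy.2⟩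
    | zero => simp
    | add a b _ _ h₁ h₂ =>
      rw [mul_add]
      exact add_mem h₁ h₂

theorem deg_internal : DirectSum.IsInternal (deg V) := by
  rw [DirectSum.isInternal_submodule_iff_iSupIndep_and_iSup_eq_top]
  constructor
  · rw [iSupIndep_def]
    intro i
    rw [Submodule.disjoint_def]
    intro x hx hx'
    have h1 : (weight V x).coeff i = x := by rw [weight_of_mem hx, Polynomial.coeff_monomial_same]
    have h2 : (⨆ j, ⨆ (_ : j ≠ i), deg V j) ≤ LinearMap.ker
        (((Polynomial.lcoeff (FreeCGA V) i).restrictScalars ℚ) ∘ₗ (weight V).toLinearMap) := by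
      refine iSup_le fun j => iSup_le fun hj => fun y hy => ?_
      simp [weight_of_mem hy, Polynomial.coeff_monomial, hj]
    have h3 : (weight V x).coeff i = 0 := by simpa using h2 hx'
    rw [← h1, h3]
  · rw [eq_top_iff]
    intro x _
    have hx : x ∈ (trunc V Set.univ).toSubmodule := by rw [trunc_univ]; trivial
    have hle : (⨆ k, deg V k ⊓ (trunc V Set.univ).toSubmodule) ≤ ⨆ k, deg V k :=
      iSup_mono fun k => inf_le_left
    exact hle (trunc_le_iSup V Set.univ hx)

/-! ### Differentials on `ΛV` -/

/-- A differential on `ΛV`, making `(ΛV, ∂)` a free commutative cochain algebra. -/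
structure Differential where
  d : FreeCGA V →ₗ[ℚ] FreeCGA V
  d_mem : ∀ {i : ℕ} {x : FreeCGA V}, x ∈ deg V i → d x ∈ deg V (i + 1)
  d_d : ∀ x : FreeCGA V, d (d x) = 0
  leibniz : ∀ {i : ℕ} {x : FreeCGA V}, x ∈ deg V i → ∀ y : FreeCGA V,
    d (x * y) = d x * y + (-1) ^ i * (x * d y)

namespace Differential

variable {V}

/-- The cochain algebra `(ΛV, ∂)`. -/
def toCochainAlgebra (D : Differential V) : CochainAlgebra (FreeCGA V) where
  deg := deg V
  internal := deg_internal V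
  one_mem := SetLike.one_mem_graded (deg V)
  mul_mem hx hy := SetLike.mul_mem_graded hx hy
  d := D.d
  d_mem := D.d_mem
  d_d := D.d_d
  leibniz := D.leibniz

/-- `∂ V^k ⊆ ΛV^{≤ k-1}` for all `k`. This says that every `ΛV^{≤ k}` is obtained from
`ΛV^{≤ k-1}` by adding generators in degree `k` only; when `V` is concentrated in degrees `≥ 2`
it means, for degree reasons, that `∂ V` consists of decomposable elements. -/
def IsMinimal (D : Differential V) : Prop :=
  ∀ (k : ℕ) (v : V k), D.d (ι V k v) ∈ trunc V (Set.Iio k)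

theorem IsMinimal.d_mem_trunc {D : Differential V} (hD : D.IsMinimal) {I : Set ℕ}
    (hI : IsLowerSet I) {x : FreeCGA V} (hx : x ∈ trunc V I) : D.d x ∈ trunc V I := by
  refine trunc_induction (P := (trunc V I).toSubmodule.comap D.d) ?_ ?_ hx
  · have h := D.leibniz (SetLike.one_mem_graded (deg V)) 1
    have h1 : D.d 1 = 0 := by simpa using h
    simp [h1]
  · intro k hk v y hy ihy
    have h1 : D.d (ι V k v) ∈ trunc V I :=
      trunc_mono V (fun j hj => hI (le_of_lt hj) hk) (hD k v)
    rw [Submodule.mem_comap, Subalgebra.mem_toSubmodule, D.leibniz (ι_mem_deg v)]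
    exact add_mem (mul_mem h1 hy) (mul_mem (pow_mem (neg_mem (one_mem _)) _)
      (mul_mem (ι_mem_trunc hk v) ihy))

/-- The sub cochain algebra `(ΛV^{I}, ∂)` of `(ΛV, ∂)`, for `I` an initial segment. -/
def truncDG (D : Differential V) (hD : D.IsMinimal) (I : Set ℕ) (hI : IsLowerSet I) :
    CochainAlgebra (trunc V I) :=
  D.toCochainAlgebra.sub (trunc V I) (trunc_le_iSup V I) fun _ hx => hD.d_mem_trunc hI hx

/-- The cochain algebra `(ΛV^{≤ n}, ∂)`. -/
def truncLE (D : Differential V) (hD : D.IsMinimal) (n : ℕ) :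
    CochainAlgebra (trunc V (Set.Iic n)) :=
  D.truncDG hD (Set.Iic n) (isLowerSet_Iic n)

/-- The cochain algebra `(ΛV^{≤ n-1}, ∂)`. -/
def truncLT (D : Differential V) (hD : D.IsMinimal) (n : ℕ) :
    CochainAlgebra (trunc V (Set.Iio n)) :=
  D.truncDG hD (Set.Iio n) (isLowerSet_Iio n)

/-- The linear map `b^n : V^n → H^{n+1}(ΛV^{≤ n-1})`, `b^n(v) = [∂ v]`. -/
def b (D : Differential V) (hD : D.IsMinimal) (n : ℕ) :
    V n →ₗ[ℚ] (D.truncLT hD n).cohomology (n + 1) :=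
  Submodule.mkQ _ ∘ₗ
    ((D.d ∘ₗ ι V n).codRestrict (trunc V (Set.Iio n)).toSubmodule (hD n)).codRestrict
      ((D.truncLT hD n).cocycles (n + 1)) fun v =>
        ⟨D.d_mem (ι_mem_deg v), Subtype.ext (D.d_d (ι V n v))⟩

/-- The inclusion `V^n → ΛV^{≤ n}`. -/
def ιLE (n : ℕ) : V n →ₗ[ℚ] trunc V (Set.Iic n) :=
  (ι V n).codRestrict (trunc V (Set.Iic n)).toSubmodule fun v => ι_mem_trunc (Set.mem_Iic.2 le_rfl) v

end Differential

end FreeCGA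

end Free

end

/-!
A vector `v ∈ V^n` with `b^n(v) = 0` satisfies `∂v = ∂u` for some `u ∈ ΛV^{≤ n-1}` of degree `n`, so
`z = v - u` is a cocycle. Choose a linear form `f` on `V^n` with `f(v) = 1` and `f(W) = 0`. For
`a ∈ ℚˣ`, the scaling `α_a`, which is the identity on `V^k` for `k ≠ n` and `x ↦ x + (a - 1) f(x) z`
on `V^n`, extends to `ΛV` because `ΛV` is graded commutative
(`FreeCGA.mul_comm_of_mem_deg`). It fixes `ΛV^{≤ n-1}` and multiplies `z` by `a`, so that
`α_a α_b = α_{ab}`. On `ΛV^{≤ n}` it commutes with `∂`: both `∂x` and `∂α_a(x) = ∂x`, for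
`x ∈ V^n`, lie in `ΛV^{≤ n-1}`, where `α_a` is the identity.

Homotopic automorphisms agree on the class of a cocycle
(`CochainAlgebra.sub_mem_map_d_of_homotopyClass_eq`): the coefficients of positive powers of `t` in
the image of a cocycle under a homotopy are coboundaries. So if `α_a` and `α_b` are homotopic, then
`(a - b) z` is the coboundary of an element of degree `n - 1`. Elements of degree `n - 1` involve
generators of degree `≤ n - 1` only (`FreeCGA.deg_le_trunc`), so minimality gives
`(a - b) v ∈ ΛV^{≤ n-1}`. But `V^n ∩ ΛV^{≤ n-1} = 0` (`FreeCGA.eq_zero_of_ι_mem_trunc`), as one sees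
by mapping `ΛV` to the dual numbers; hence `a = b`.
-/

/-! ### Homotopic automorphisms on cocycles -/

namespace CochainAlgebra

variable {A : Type*} [Ring A] [Algebra ℚ A] {𝒜 : CochainAlgebra A}

theorem Homotopy.coeff_succ_mem_map_d {α β : A →ₐ[ℚ] A} (H : 𝒜.Homotopy α β) {m : ℕ} {z : A}
    (hz : z ∈ 𝒜.deg (m + 1)) (hdz : 𝒜.d z = 0) (i : ℕ) :
    (H.Φ z).coeff (i + 1) ∈ (𝒜.deg m).map 𝒜.d := by
  have h := H.Ψ_d hz i
  rw [hdz, map_zero, Polynomial.coeff_zero, Polynomial.coeff_derivative] at h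
  have hmem := Submodule.mem_map_of_mem (f := 𝒜.d) (H.Ψ_mem hz i)
  have hc : ((i : ℚ) + 1) • (H.Φ z).coeff (i + 1) = (H.Φ z).coeff (i + 1) * ((i : A) + 1) := by
    rw [Algebra.smul_def, Algebra.commutes]
    simp
  rw [← hc] at h
  have key : ((i : ℚ) + 1) • (H.Φ z).coeff (i + 1) ∈ (𝒜.deg m).map 𝒜.d := by
    rcases neg_one_pow_eq_or A (m + 1) with h1 | h1 <;> rw [h1] at h
    · rw [one_mul] at h
      rw [← neg_eq_of_add_eq_zero_right h.symm]
      exact neg_mem hmem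
    · rw [neg_one_mul, ← sub_eq_add_neg] at h
      rw [← sub_eq_zero.1 h.symm]
      exact hmem
  exact (Submodule.smul_mem_iff _ (by positivity)).1 key

theorem Homotopy.sub_mem_map_d {α β : A →ₐ[ℚ] A} (H : 𝒜.Homotopy α β) {m : ℕ} {z : A}
    (hz : z ∈ 𝒜.deg (m + 1)) (hdz : 𝒜.d z = 0) : β z - α z ∈ (𝒜.deg m).map 𝒜.d := by
  rw [← H.eval_zero, ← H.eval_one, ← Polynomial.coeff_zero_eq_eval_zero,
    Polynomial.eval_eq_sum_range, Finset.sum_range_succ']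
  simp only [one_pow, mul_one, add_sub_cancel_right]
  exact Submodule.sum_mem _ fun i _ => H.coeff_succ_mem_map_d hz hdz i

/-- Automorphisms in the same homotopy class induce the same map in cohomology of positive
degree. -/
theorem sub_mem_map_d_of_homotopyClass_eq {α β : 𝒜.aut}
    (h : 𝒜.homotopyClass α = 𝒜.homotopyClass β) {m : ℕ} {z : A} (hz : z ∈ 𝒜.deg (m + 1))
    (hdz : 𝒜.d z = 0) : α.1 z - β.1 z ∈ (𝒜.deg m).map 𝒜.d := by
  replace h : Relation.EqvGen 𝒜.Homotopic α β := (Con.eq _).1 h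
  induction h with
  | rel _ _ h =>
    obtain ⟨H⟩ := h
    rw [← neg_sub]
    exact neg_mem (H.sub_mem_map_d hz hdz)
  | refl _ => simp
  | symm _ _ _ ih =>
    rw [← neg_sub]
    exact neg_mem ih
  | trans x y w _ _ ih₁ ih₂ =>
    rw [← sub_add_sub_cancel _ (y.1 z)]
    exact add_mem ih₁ ih₂

end CochainAlgebra

namespace FreeCGA

variable {V : ℕ → Type*} [∀ k, AddCommGroup (V k)] [∀ k, Module ℚ (V k)]

/-! ### Graded commutativity, and degrees of generators -/

theorem ι_mul_of_mem_deg {i j : ℕ} (v : V i) {y : FreeCGA V} (hy : y ∈ deg V j) :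
    ι V i v * y = (-1) ^ (i * j) * (y * ι V i v) := by
  induction hy using Submodule.span_induction with
  | mem y hy =>
    obtain ⟨l, rfl, rfl⟩ := hy
    induction l with
    | nil => simp
    | cons p l ih =>
      simp only [List.map_cons, List.prod_cons, List.sum_cons]
      rw [← mul_assoc, ι_mul_ι, mul_assoc, mul_assoc, ih, mul_add, pow_add, mul_assoc, mul_assoc]
      congr 1
      rw [← mul_assoc, ← mul_assoc, ((Commute.neg_one_left _).pow_left _).symm.eq, mul_assoc,
        mul_assoc]
  | zero => simp
  | add _ _ _ _ h₁ h₂ => rw [mul_add, add_mul, h₁, h₂, mul_add]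
  | smul c _ _ h => rw [mul_smul_comm, h, smul_mul_assoc, mul_smul_comm]

theorem mul_comm_of_mem_deg {i j : ℕ} {x y : FreeCGA V} (hx : x ∈ deg V i) (hy : y ∈ deg V j) :
    x * y = (-1) ^ (i * j) * (y * x) := by
  induction hx using Submodule.span_induction with
  | mem x hx =>
    obtain ⟨l, rfl, rfl⟩ := hx
    induction l with
    | nil => simp
    | cons p l ih =>
      simp only [List.map_cons, List.prod_cons, List.sum_cons]
      rw [mul_assoc, ih, ← mul_assoc, ((Commute.neg_one_left _).pow_left _).symm.eq, mul_assoc,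
        ← mul_assoc (ι V _ _), ι_mul_of_mem_deg p.2 hy, add_mul, add_comm, pow_add]
      simp only [mul_assoc]
  | zero => simp
  | add _ _ _ _ h₁ h₂ => rw [mul_add, add_mul, h₁, h₂, mul_add]
  | smul c _ _ h => rw [mul_smul_comm, smul_mul_assoc, h, mul_smul_comm]

theorem trunc_le {I : Set ℕ} {S : Subalgebra ℚ (FreeCGA V)} (h : ∀ k ∈ I, ∀ v, ι V k v ∈ S) :
    trunc V I ≤ S := by
  refine Algebra.adjoin_le ?_
  rintro _ ⟨k, hk, v, rfl⟩
  exact h k hk v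

theorem deg_le_trunc (m : ℕ) : deg V m ≤ (trunc V (Set.Iic m)).toSubmodule := by
  refine Submodule.span_le.2 ?_
  rintro _ ⟨l, rfl, rfl⟩
  have h : (l.map fun p => ι V p.1 p.2).prod ∈ trunc V (Set.Iic (l.map Sigma.fst).sum) := by
    refine list_prod_mem fun x hx => ?_
    obtain ⟨p, hp, rfl⟩ := List.mem_map.1 hx
    exact ι_mem_trunc (Set.mem_Iic.2 (List.le_sum_of_mem (List.mem_map_of_mem hp))) p.2
  exact h

theorem eq_zero_of_ι_mem_trunc {I : Set ℕ} {n : ℕ} (hn : n ∉ I) {v : V n}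
    (hv : ι V n v ∈ trunc V I) : v = 0 := by
  refine (Module.forall_dual_apply_eq_zero_iff ℚ v).1 fun f => ?_
  -- The algebra map `ΛV → ℚ[ε]` with `x ↦ f(x) ε` on `V^n`, killing the other generators.
  let g : ∀ k, V k →ₗ[ℚ] TrivSqZeroExt ℚ ℚ := fun k =>
    TrivSqZeroExt.inrHom ℚ ℚ ∘ₗ (Pi.single n f : ∀ k, V k →ₗ[ℚ] ℚ) k
  let φ : FreeCGA V →ₐ[ℚ] TrivSqZeroExt ℚ ℚ := lift g fun i j v w => by simp [g]
  have hφ : trunc V I ≤ (⊥ : Subalgebra ℚ (TrivSqZeroExt ℚ ℚ)).comap φ := by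
    refine trunc_le fun k hk w => ?_
    have : φ (ι V k w) = 0 := by
      simp [φ, g, Pi.single_eq_of_ne (ne_of_mem_of_not_mem hk hn)]
    rw [Subalgebra.mem_comap, this]
    exact zero_mem _
  obtain ⟨c, hc⟩ := Algebra.mem_bot.1 (hφ hv)
  have h := congrArg TrivSqZeroExt.snd hc
  simpa [φ, g, TrivSqZeroExt.algebraMap_eq_inl] using h.symm

/-! ### Scaling along a homogeneous element -/

/-- The endomorphism of `ΛV` which is `x ↦ x + (a - 1) f(x) z` on `V^n` and the identity on `V^k`
for `k ≠ n`. -/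
def scaling {n : ℕ} (f : V n →ₗ[ℚ] ℚ) {z : FreeCGA V} (hz : z ∈ deg V n) (a : ℚ) :
    FreeCGA V →ₐ[ℚ] FreeCGA V :=
  lift (fun k => ι V k + (a - 1) • (Pi.single n (f.smulRight z) : ∀ k, V k →ₗ[ℚ] FreeCGA V) k)
    (by
      have h : ∀ k (v : V k), (ι V k +
          (a - 1) • (Pi.single n (f.smulRight z) : ∀ k, V k →ₗ[ℚ] FreeCGA V) k) v ∈ deg V k := by
        intro k v
        refine add_mem (ι_mem_deg v) (Submodule.smul_mem _ _ ?_)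
        by_cases hk : k = n
        · subst hk
          rw [Pi.single_eq_same]
          exact Submodule.smul_mem _ _ hz
        · rw [Pi.single_eq_of_ne hk]
          exact zero_mem _
      exact fun i j v w => mul_comm_of_mem_deg (h i v) (h j w))

section scaling

variable {n : ℕ} (f : V n →ₗ[ℚ] ℚ) {z : FreeCGA V} (hz : z ∈ deg V n) (a b : ℚ)

theorem scaling_ι (v : V n) : scaling f hz a (ι V n v) = ι V n v + ((a - 1) * f v) • z := by
  simp [scaling, mul_smul]

theorem scaling_ι_of_ne {k : ℕ} (hk : k ≠ n) (v : V k) :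
    scaling f hz a (ι V k v) = ι V k v := by
  simp [scaling, Pi.single_eq_of_ne hk]

theorem scaling_ι_mem_deg {k : ℕ} (v : V k) : scaling f hz a (ι V k v) ∈ deg V k := by
  by_cases hk : k = n
  · subst hk
    rw [scaling_ι]
    exact add_mem (ι_mem_deg v) (Submodule.smul_mem _ _ hz)
  · rw [scaling_ι_of_ne f hz a hk]
    exact ι_mem_deg v

theorem scaling_mem_deg {m : ℕ} {x : FreeCGA V} (hx : x ∈ deg V m) :
    scaling f hz a x ∈ deg V m := by
  refine (Submodule.span_le (p := (deg V m).comap (scaling f hz a).toLinearMap)).2 ?_ hx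
  rintro _ ⟨l, rfl, rfl⟩
  clear hx
  change scaling f hz a _ ∈ deg V _
  induction l with
  | nil => simpa using SetLike.one_mem_graded (deg V)
  | cons p l ih =>
    simp only [List.map_cons, List.prod_cons, List.sum_cons, map_mul]
    exact SetLike.mul_mem_graded (scaling_ι_mem_deg f hz a p.2) ih

theorem scaling_of_mem_trunc {x : FreeCGA V} (hx : x ∈ trunc V (Set.Iio n)) :
    scaling f hz a x = x := by
  exact trunc_le (S := AlgHom.equalizer (scaling f hz a) (AlgHom.id ℚ _))
    (fun k hk v => scaling_ι_of_ne f hz a (ne_of_lt hk) v) hx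

theorem scaling_mem_trunc {x : FreeCGA V} (hx : x ∈ trunc V (Set.Iic n)) :
    scaling f hz a x ∈ trunc V (Set.Iic n) := by
  exact trunc_le (S := (trunc V (Set.Iic n)).comap (scaling f hz a)) (fun k hk v =>
    trunc_mono V (Set.Iic_subset_Iic.2 hk) (deg_le_trunc k (scaling_ι_mem_deg f hz a v))) hx

theorem scaling_one : scaling f hz 1 = AlgHom.id ℚ _ := by
  refine hom_ext fun k v => ?_
  by_cases hk : k = n
  · subst hk
    simp [scaling_ι]
  · simp [scaling_ι_of_ne f hz 1 hk]

variable {f hz} in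
/-- If `v - z ∈ ΛV^{≤ n-1}` for some `v ∈ V^n` with `f(v) = 1`, then `scaling f hz a` multiplies `z`
by `a`. -/
theorem scaling_self {v : V n} (hfv : f v = 1) (hzv : ι V n v - z ∈ trunc V (Set.Iio n)) :
    scaling f hz a z = a • z := by
  have h := scaling_of_mem_trunc f hz a hzv
  rw [map_sub, scaling_ι, hfv, mul_one, sub_smul, one_smul] at h
  calc scaling f hz a z
      = ι V n v + (a • z - z) - (ι V n v + (a • z - z) - scaling f hz a z) := by abel
    _ = a • z := by rw [h]; abel

variable {f hz} in
theorem scaling_comp_scaling (hself : ∀ a, scaling f hz a z = a • z) :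
    (scaling f hz a).comp (scaling f hz b) = scaling f hz (a * b) := by
  refine hom_ext fun k v => ?_
  by_cases hk : k = n
  · subst hk
    rw [AlgHom.comp_apply, scaling_ι, map_add, map_smul, hself, scaling_ι, scaling_ι, smul_smul,
      add_assoc, ← add_smul]
    congr 2
    ring
  · simp only [AlgHom.comp_apply, scaling_ι_of_ne f hz _ hk]

variable {f hz} in
theorem scaling_d {D : Differential V} (hD : D.IsMinimal) (hdz : D.d z = 0) {x : FreeCGA V}
    (hx : x ∈ trunc V (Set.Iic n)) : scaling f hz a (D.d x) = D.d (scaling f hz a x) := by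
  have hgen : ∀ k ≤ n, ∀ v : V k,
      scaling f hz a (D.d (ι V k v)) = D.d (scaling f hz a (ι V k v)) := by
    intro k hk v
    rw [scaling_of_mem_trunc f hz a (trunc_mono V (Set.Iio_subset_Iio hk) (hD k v))]
    rcases hk.eq_or_lt with rfl | hk
    · simp [scaling_ι, hdz]
    · rw [scaling_ι_of_ne f hz a hk.ne]
  refine trunc_induction (P := LinearMap.eqLocus ((scaling f hz a).toLinearMap ∘ₗ D.d)
    (D.d ∘ₗ (scaling f hz a).toLinearMap)) ?_ ?_ hx
  · have h1 : D.d 1 = 0 := by simpa using D.leibniz (SetLike.one_mem_graded (deg V)) 1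
    simp [h1]
  · intro k hk v y _ hy
    simp only [LinearMap.mem_eqLocus, LinearMap.comp_apply, AlgHom.toLinearMap_apply] at hy ⊢
    rw [D.leibniz (ι_mem_deg v), map_mul, D.leibniz (scaling_ι_mem_deg f hz a v), map_add, map_mul,
      hgen k hk v, map_mul, map_mul, hy]
    simp

end scaling

/-! ### Automorphisms scaling a cocycle -/

namespace Differential

/-- The scaling by `a ∈ ℚˣ` along a cocycle `z` of degree `n`, as an automorphism of
`(ΛV^{≤ n}, ∂)` with inverse the scaling by `a⁻¹`. -/
def scalingAut {D : Differential V} (hD : D.IsMinimal) {n : ℕ} {f : V n →ₗ[ℚ] ℚ} {z : FreeCGA V}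
    {hz : z ∈ deg V n} (hdz : D.d z = 0) (hself : ∀ a, scaling f hz a z = a • z) (a : ℚˣ) :
    (D.truncLE hD n).aut :=
  have hcomp : ∀ (a b : ℚ) (_ : a * b = 1) (x : FreeCGA V),
      scaling f hz a (scaling f hz b x) = x := fun a b hab x => by
    rw [← AlgHom.comp_apply, scaling_comp_scaling a b hself, hab, scaling_one, AlgHom.id_apply]
  let r (a : ℚ) : trunc V (Set.Iic n) →ₐ[ℚ] trunc V (Set.Iic n) :=
    ((scaling f hz a).comp (trunc V (Set.Iic n)).val).codRestrict _
      fun x => scaling_mem_trunc f hz a x.2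
  ⟨AlgEquiv.ofAlgHom (r a) (r ↑a⁻¹)
      (AlgHom.ext fun x => Subtype.ext (hcomp a ↑a⁻¹ a.mul_inv x))
      (AlgHom.ext fun x => Subtype.ext (hcomp ↑a⁻¹ a a.inv_mul x)),
    fun k x => ⟨fun hx => by
        have h : scaling f hz ↑a⁻¹ (scaling f hz a x) ∈ deg V k := scaling_mem_deg f hz _ hx
        rwa [hcomp ↑a⁻¹ a a.inv_mul x] at h,
      fun hx => scaling_mem_deg f hz a hx⟩,
    fun x => Subtype.ext (scaling_d (a : ℚ) hD hdz x.2)⟩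

theorem coe_scalingAut_apply {D : Differential V} (hD : D.IsMinimal) {n : ℕ} {f : V n →ₗ[ℚ] ℚ}
    {z : FreeCGA V} {hz : z ∈ deg V n} (hdz : D.d z = 0)
    (hself : ∀ a, scaling f hz a z = a • z) (a : ℚˣ) (x : trunc V (Set.Iic n)) :
    ((scalingAut hD hdz hself a).1 x : FreeCGA V) = scaling f hz a x :=
  rfl

/-- The kernel of `b^n`, in terms of representatives. -/
theorem exists_d_eq_of_b_eq_zero {D : Differential V} {hD : D.IsMinimal} {n : ℕ} {v : V n}
    (hv : D.b hD n v = 0) : ∃ u ∈ trunc V (Set.Iio n), u ∈ deg V n ∧ D.d u = D.d (ι V n v) := by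
  have h := (Submodule.Quotient.mk_eq_zero _).1 hv
  obtain ⟨u, hu, hud⟩ := h
  exact ⟨u, u.2, hu, congrArg Subtype.val hud⟩

/-- Distinct scalings of a cocycle which involves `V^n` are not homotopic. -/
theorem injective_homotopyClass_scalingAut {D : Differential V} (hD : D.IsMinimal) {m : ℕ}
    {f : V (m + 1) →ₗ[ℚ] ℚ} {z : FreeCGA V} {hz : z ∈ deg V (m + 1)} (hdz : D.d z = 0)
    (hself : ∀ a, scaling f hz a z = a • z) (hzn : z ∈ trunc V (Set.Iic (m + 1)))
    (hzt : z ∉ trunc V (Set.Iio (m + 1))) :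
    Function.Injective fun a => (D.truncLE hD (m + 1)).homotopyClass
      (scalingAut hD hdz hself a) := by
  intro a b hab
  obtain ⟨y, hy, hyd⟩ := CochainAlgebra.sub_mem_map_d_of_homotopyClass_eq hab (m := m)
    (z := ⟨z, hzn⟩) hz (Subtype.ext hdz)
  have hyd' : D.d y = scaling f hz a z - scaling f hz b z := congrArg Subtype.val hyd
  rw [hself, hself, ← sub_smul] at hyd'
  have hyt : (y : FreeCGA V) ∈ trunc V (Set.Iio (m + 1)) :=
    trunc_mono V (fun k hk => Nat.lt_succ_of_le hk) (deg_le_trunc m hy)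
  have hmem : ((a : ℚ) - b) • z ∈ (trunc V (Set.Iio (m + 1))).toSubmodule := by
    rw [← hyd']
    exact hD.d_mem_trunc (isLowerSet_Iio _) hyt
  by_contra hne
  exact hzt ((Submodule.smul_mem_iff _ (sub_ne_zero.2 fun h => hne (Units.ext h))).1 hmem)

end Differential

end FreeCGA

open FreeCGA FreeCGA.Differential in
/-- The automorphisms `α_a` attached to a nonzero vector in the kernel of `b^{m+1}`;
positive degrees suffice when `V^0 = 0`. -/
theorem exists_aut_of_b_eq_zero {V : ℕ → Type*} [∀ k, AddCommGroup (V k)] [∀ k, Module ℚ (V k)]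
    (D : FreeCGA.Differential V) (hD : D.IsMinimal) {m : ℕ} {v : V (m + 1)} (hv0 : v ≠ 0)
    (hv : D.b hD (m + 1) v = 0) {W : Submodule ℚ (V (m + 1))} (hW : IsCompl (ℚ ∙ v) W) :
    ∃ α : ℚˣ → (D.truncLE hD (m + 1)).aut,
      Function.Injective (fun a => (D.truncLE hD (m + 1)).homotopyClass (α a)) ∧
      ∀ a : ℚˣ,
        (∀ x : trunc V (Set.Iic (m + 1)), (x : FreeCGA V) ∈ trunc V (Set.Iio (m + 1)) →
          (α a).1 x = x) ∧
        (((α a).1 (ιLE (m + 1) v) : FreeCGA V) - (a : ℚ) • ι V (m + 1) v ∈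
          trunc V (Set.Iio (m + 1))) ∧
        ∀ w ∈ W, ((α a).1 (ιLE (m + 1) w) : FreeCGA V) - ι V (m + 1) w ∈
          trunc V (Set.Iio (m + 1)) := by
  obtain ⟨u, hut, hud, hdu⟩ := exists_d_eq_of_b_eq_zero hv
  have hvW : v ∉ W := fun h =>
    hv0 (Submodule.disjoint_def.1 hW.disjoint v (Submodule.mem_span_singleton_self v) h)
  obtain ⟨f, hfv, hfW⟩ : ∃ f : V (m + 1) →ₗ[ℚ] ℚ, f v = 1 ∧ ∀ w ∈ W, f w = 0 := by
    obtain ⟨g, hgv, hgW⟩ := Submodule.exists_le_ker_of_notMem hvW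
    exact ⟨(g v)⁻¹ • g, by simp [hgv], fun w hw => by simp [LinearMap.mem_ker.1 (hgW hw)]⟩
  have hz : ι V (m + 1) v - u ∈ deg V (m + 1) := sub_mem (ι_mem_deg v) hud
  have hdz : D.d (ι V (m + 1) v - u) = 0 := by rw [map_sub, hdu, sub_self]
  have hself : ∀ a, scaling f hz a (ι V (m + 1) v - u) = a • (ι V (m + 1) v - u) := fun a =>
    scaling_self a hfv (by rwa [sub_sub_cancel])
  have hzt : ι V (m + 1) v - u ∉ trunc V (Set.Iio (m + 1)) := fun h =>
    hv0 (eq_zero_of_ι_mem_trunc Set.self_notMem_Iio (by simpa using add_mem h hut))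
  refine ⟨scalingAut hD hdz hself,
    injective_homotopyClass_scalingAut hD hdz hself (deg_le_trunc _ hz) hzt, fun a => ⟨?_, ?_, ?_⟩⟩
  · exact fun x hx => Subtype.ext (scaling_of_mem_trunc f hz a hx)
  · have h : ((scalingAut hD hdz hself a).1 (ιLE (m + 1) v) : FreeCGA V) =
        ι V (m + 1) v + (((a : ℚ) - 1) * f v) • (ι V (m + 1) v - u) := scaling_ι f hz a v
    have h' : ι V (m + 1) v + (((a : ℚ) - 1) * f v) • (ι V (m + 1) v - u) -
        (a : ℚ) • ι V (m + 1) v = (1 - (a : ℚ)) • u := by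
      rw [hfv]
      module
    rw [h, h']
    exact Subalgebra.smul_mem _ hut _
  · intro w hw
    have h : ((scalingAut hD hdz hself a).1 (ιLE (m + 1) w) : FreeCGA V) =
        ι V (m + 1) w + (((a : ℚ) - 1) * f w) • (ι V (m + 1) v - u) := scaling_ι f hz a w
    rw [h, hfW w hw, mul_zero, zero_smul, add_zero, sub_self]
    exact zero_mem _

theorem proposition2p13 {V : ℕ → Type*} [∀ k, AddCommGroup (V k)] [∀ k, Module ℚ (V k)]
    (hV : ∀ k < 2, Subsingleton (V k))
    (D : FreeCGA.Differential V) (hD : D.IsMinimal) (n : ℕ) :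
    (Finite (D.truncLE hD n).E → Function.Injective (D.b hD n)) ∧
    ∀ v : V n, v ≠ 0 → D.b hD n v = 0 → ∀ W : Submodule ℚ (V n), IsCompl (ℚ ∙ v) W →
      ∃ α : ℚˣ → (D.truncLE hD n).aut,
        Function.Injective (fun a => (D.truncLE hD n).homotopyClass (α a)) ∧
        ∀ a : ℚˣ,
          (∀ x : FreeCGA.trunc V (Set.Iic n), (x : FreeCGA V) ∈ FreeCGA.trunc V (Set.Iio n) →
            (α a).1 x = x) ∧
          (((α a).1 (FreeCGA.Differential.ιLE n v) : FreeCGA V)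
            - (a : ℚ) • FreeCGA.ι V n v ∈ FreeCGA.trunc V (Set.Iio n)) ∧
          ∀ w ∈ W, ((α a).1 (FreeCGA.Differential.ιLE n w) : FreeCGA V)
            - FreeCGA.ι V n w ∈ FreeCGA.trunc V (Set.Iio n) := by
  rcases n with _ | m
  · have := hV 0 two_pos
    exact ⟨fun _ => Function.injective_of_subsingleton _,
      fun v hv => absurd (Subsingleton.elim v 0) hv⟩
  refine ⟨fun hfin => ?_, fun v hv0 hv W hW => exists_aut_of_b_eq_zero D hD hv0 hv hW⟩
  rw [injective_iff_map_eq_zero]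
  intro v hv
  by_contra hv0
  obtain ⟨W, hW⟩ := Submodule.exists_isCompl (ℚ ∙ v)
  obtain ⟨α, hα, -⟩ := exists_aut_of_b_eq_zero D hD hv0 hv hW
  have := Finite.of_injective _ hα
  have : Infinite ℚˣ := Infinite.of_injective
    (fun k : ℕ => Units.mk0 ((k : ℚ) + 1) (by positivity)) fun k l h => by simpa using h
  exact not_finite ℚˣ
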